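/- Let $k$ be a field, let $V$ be a $k$-vector space of finite dimension $n\ge 1$ with basis $(x_1,\dots,x_n)$, and let $N\ge 2$. Let $T(V)$ be the tensor algebra, filtered by $F^m=k\oplus V\oplus\cdots\oplus V^{\otimes m}$ ($m\ge 0$). Let $R=k\,x_1^N\subseteq V^{\otimes N}$, let $A=T(V)/I(R)$, where $I(S)$ denotes the two-sided ideal generated by a subspace $S$, let $\varphi:R\to F^{N-1}$ be a $k$-linear map, put $P=(\mathrm{Id}-\varphi)(R)\subseteq F^N$ and $U=T(V)/I(P)$, i.e. $U=T(V)/(x_1^N-\varphi(x_1^N))$, filtered by the images of the $F^m$. There is a natural morphism of graded algebras $p:A\to\mathrm{gr}(U)$, sending the class of a homogeneous tensor of degree $i$ to the class of its image in $F^iU/F^{i-1}U$ (with $F^{-1}U=0$). The filtered algebra $U$ is called a PBW deformation of $A$ if $p$ is an isomorphism. Then $U$ is a PBW deformation of $A$ if and only if $\varphi(x_1^N)$ is a polynomial in $x_1$, i.e. $\varphi(x_1^N)=q(x_1)$ in $T(V)$ for some $q\in k[X]$. -/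

import Mathlib

open scoped DirectSum

noncomputable section

namespace PBW

/-! ### The associated graded algebra of a filtered algebra -/

section AssociatedGraded

/-- The preceding step of an `ℕ`-indexed filtration, with the convention `F (-1) = 0`. -/
def filtPred {k U : Type*} [Field k] [Ring U] [Algebra k U] (F : ℕ → Submodule k U) :
    ℕ → Submodule k U
  | 0 => ⊥
  | i + 1 => F i

/-- The component `gr_i = F i / F (i - 1)`. -/
def GrPiece {k U : Type*} [Field k] [Ring U] [Algebra k U] (F : ℕ → Submodule k U) (i : ℕ) :
    Type _ :=
  F i ⧸ (filtPred F i).submoduleOf (F i)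

variable {k U : Type*} [Field k] [Ring U] [Algebra k U] (F : ℕ → Submodule k U)

instance (i : ℕ) : AddCommGroup (GrPiece F i) :=
  inferInstanceAs (AddCommGroup (F i ⧸ (filtPred F i).submoduleOf (F i)))

instance (i : ℕ) : Module k (GrPiece F i) :=
  inferInstanceAs (Module k (F i ⧸ (filtPred F i).submoduleOf (F i)))

/-- The class in `gr_i` (the symbol) of an element of `F i`. -/
def grMk (i : ℕ) : F i →ₗ[k] GrPiece F i :=
  ((filtPred F i).submoduleOf (F i)).mkQ

theorem grMk_surjective (i : ℕ) : Function.Surjective (grMk F i) :=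
  Submodule.mkQ_surjective _

theorem grMk_eq_zero {i : ℕ} {x : F i} : grMk F i x = 0 ↔ (x : U) ∈ filtPred F i :=
  Submodule.Quotient.mk_eq_zero ((filtPred F i).submoduleOf (F i))

theorem gradedMonoid_mk_grMk {i j : ℕ} (h : i = j) {x : F i} {y : F j} (hxy : (x : U) = y) :
    GradedMonoid.mk (A := GrPiece F) i (grMk F i x) = GradedMonoid.mk j (grMk F j y) := by
  subst h
  rw [Subtype.ext hxy]

/-- A sequence of subspaces of `U` that is increasing, contains `1` in degree `0`, and is
multiplicative, is a ring filtration. -/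
theorem isRingFiltration_of (hmono : Monotone F) (hone : (1 : U) ∈ F 0)
    (hmul : ∀ ⦃i j : ℕ⦄ ⦃a b : U⦄, a ∈ F i → b ∈ F j → a * b ∈ F (i + j)) :
    IsRingFiltration F (filtPred F) where
  mono := hmono
  is_le {i j} h := by
    cases j with
    | zero => exact absurd h (Nat.not_lt_zero _)
    | succ j => exact hmono (Nat.lt_succ_iff.mp h)
  is_sup B j h := by
    cases j with
    | zero => exact bot_le
    | succ j => exact h j (Nat.lt_succ_self j)
  one_mem := hone
  mul_mem _ _ _ _ ha hb := hmul ha hb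

variable [IsRingFiltration F (filtPred F)]

theorem mul_mem_filt {i j : ℕ} {a b : U} (ha : a ∈ F i) (hb : b ∈ F j) : a * b ∈ F (i + j) :=
  SetLike.mul_mem_graded ha hb

theorem filtPred_mul_mem {i j : ℕ} {a b : U} (ha : a ∈ filtPred F i) (hb : b ∈ F j) :
    a * b ∈ filtPred F (i + j) := by
  cases i with
  | zero =>
    rw [(Submodule.mem_bot k).mp ha, zero_mul]
    exact Submodule.zero_mem _
  | succ i =>
    rw [Nat.succ_add]
    exact mul_mem_filt F ha hb

theorem mul_filtPred_mem {i j : ℕ} {a b : U} (ha : a ∈ F i) (hb : b ∈ filtPred F j) :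
    a * b ∈ filtPred F (i + j) := by
  cases j with
  | zero =>
    rw [(Submodule.mem_bot k).mp hb, mul_zero]
    exact Submodule.zero_mem _
  | succ j => exact mul_mem_filt F ha hb

/-- The multiplication `F i × F j → F (i + j)`. -/
def filtMul (i j : ℕ) : F i →ₗ[k] F j →ₗ[k] F (i + j) :=
  LinearMap.mk₂ k (fun a b => ⟨(a : U) * b, mul_mem_filt F a.2 b.2⟩)
    (fun _ _ _ => Subtype.ext (add_mul _ _ _)) (fun _ _ _ => Subtype.ext (smul_mul_assoc _ _ _))
    (fun _ _ _ => Subtype.ext (mul_add _ _ _)) (fun _ _ _ => Subtype.ext (mul_smul_comm _ _ _))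

/-- The multiplication `gr_i × gr_j → gr_{i + j}` induced by that of `U`. -/
def grMul (i j : ℕ) : GrPiece F i →ₗ[k] GrPiece F j →ₗ[k] GrPiece F (i + j) :=
  Submodule.liftQ _
    (LinearMap.flip
      (Submodule.liftQ _ ((filtMul F i j).compr₂ (grMk F (i + j))).flip (by
        intro b hb
        rw [LinearMap.mem_ker]
        ext a
        exact (grMk_eq_zero F).mpr (mul_filtPred_mem F a.2 hb))))
    (by
      intro a ha
      rw [LinearMap.mem_ker]
      refine LinearMap.ext fun b => ?_
      obtain ⟨b, rfl⟩ := grMk_surjective F j b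
      exact (grMk_eq_zero F).mpr (filtPred_mul_mem F ha b.2))

theorem grMul_grMk {i j : ℕ} (a : F i) (b : F j) :
    grMul F i j (grMk F i a) (grMk F j b) =
      grMk F (i + j) ⟨(a : U) * b, mul_mem_filt F a.2 b.2⟩ :=
  rfl

theorem algebraMap_mem_filt_zero (r : k) : algebraMap k U r ∈ F 0 := by
  rw [Algebra.algebraMap_eq_smul_one]
  exact Submodule.smul_mem _ _ (SetLike.one_mem_graded F)

instance grGOne : GradedMonoid.GOne (GrPiece F) where
  one := grMk F 0 ⟨1, SetLike.one_mem_graded F⟩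

instance grGMul : GradedMonoid.GMul (GrPiece F) where
  mul a b := grMul F _ _ a b

instance grGRing : DirectSum.GRing (GrPiece F) where
  __ := grGOne F
  __ := grGMul F
  mul_zero a := map_zero _
  zero_mul b := LinearMap.map_zero₂ (grMul F _ _) b
  mul_add a b c := map_add _ _ _
  add_mul a b c := LinearMap.map_add₂ (grMul F _ _) a b c
  one_mul := by
    rintro ⟨i, a⟩
    obtain ⟨a, rfl⟩ := grMk_surjective F i a
    exact gradedMonoid_mk_grMk F (zero_add i) (one_mul _)
  mul_one := by
    rintro ⟨i, a⟩
    obtain ⟨a, rfl⟩ := grMk_surjective F i a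
    exact gradedMonoid_mk_grMk F (add_zero i) (mul_one _)
  mul_assoc := by
    rintro ⟨i, a⟩ ⟨j, b⟩ ⟨l, c⟩
    obtain ⟨a, rfl⟩ := grMk_surjective F i a
    obtain ⟨b, rfl⟩ := grMk_surjective F j b
    obtain ⟨c, rfl⟩ := grMk_surjective F l c
    exact gradedMonoid_mk_grMk F (add_assoc i j l) (mul_assoc _ _ _)
  natCast n := n • grMk F 0 ⟨1, SetLike.one_mem_graded F⟩
  natCast_zero := zero_smul _ _
  natCast_succ n := succ_nsmul _ _
  intCast n := n • grMk F 0 ⟨1, SetLike.one_mem_graded F⟩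
  intCast_ofNat n := natCast_zsmul _ _
  intCast_negSucc_ofNat n := negSucc_zsmul _ _

instance grGAlgebra : DirectSum.GAlgebra k (GrPiece F) where
  toFun :=
    { toFun := fun r => grMk F 0 ⟨algebraMap k U r, algebraMap_mem_filt_zero F r⟩
      map_zero' := by
        rw [grMk_eq_zero]
        exact (map_zero (algebraMap k U))
      map_add' := fun r s => by
        rw [← map_add]
        exact congrArg _ (Subtype.ext (map_add _ r s)) }
  map_one := congrArg (grMk F 0) (Subtype.ext (map_one _))
  map_mul r s := gradedMonoid_mk_grMk F (add_zero 0).symm (map_mul _ r s)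
  commutes r := by
    rintro ⟨i, a⟩
    obtain ⟨a, rfl⟩ := grMk_surjective F i a
    exact gradedMonoid_mk_grMk F (add_comm 0 i) (Algebra.commutes r (a : U))
  smul_def r := by
    rintro ⟨i, a⟩
    obtain ⟨a, rfl⟩ := grMk_surjective F i a
    exact gradedMonoid_mk_grMk F (x := r • a) (zero_add i).symm (Algebra.smul_def r (a : U))

/-- The associated graded algebra `gr(U) = ⨁ i, F i / F (i - 1)` of the filtered algebra `U`. -/
abbrev AssocGraded : Type _ := ⨁ i, GrPiece F i

end AssociatedGraded

/-! ### The tensor algebra, its filtration, and quotients -/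

section Tensor

variable (k V : Type*) [Field k] [AddCommGroup V] [Module k V]

/-- The subspace `V^{⊗ i}` of the tensor algebra. -/
def tensorDeg (i : ℕ) : Submodule k (TensorAlgebra k V) :=
  LinearMap.range (TensorAlgebra.ι k : V →ₗ[k] TensorAlgebra k V) ^ i

/-- The filtration `F^m = k ⊕ V ⊕ ⋯ ⊕ V^{⊗ m}` of the tensor algebra. -/
def tensorFilt (m : ℕ) : Submodule k (TensorAlgebra k V) :=
  ⨆ i : Fin (m + 1), tensorDeg k V i

theorem tensorDeg_le_tensorFilt {i m : ℕ} (h : i ≤ m) : tensorDeg k V i ≤ tensorFilt k V m :=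
  le_iSup (fun j : Fin (m + 1) => tensorDeg k V j) ⟨i, Nat.lt_succ_of_le h⟩

theorem tensorFilt_mono : Monotone (tensorFilt k V) := fun _ _ h =>
  iSup_le fun i => tensorDeg_le_tensorFilt k V ((Nat.lt_succ_iff.mp i.2).trans h)

theorem tensorFilt_mul_le (i j : ℕ) :
    tensorFilt k V i * tensorFilt k V j ≤ tensorFilt k V (i + j) := by
  unfold tensorFilt
  rw [Submodule.iSup_mul]
  refine iSup_le fun a => ?_
  rw [Submodule.mul_iSup]
  refine iSup_le fun b => ?_
  have : tensorDeg k V a * tensorDeg k V b = tensorDeg k V (a + b) := (pow_add _ _ _).symm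
  rw [this]
  exact tensorDeg_le_tensorFilt k V (by omega)

variable {k V}

/-- The two-sided ideal `I(S)` generated by a subspace `S` of the tensor algebra. -/
def relIdeal (S : Submodule k (TensorAlgebra k V)) : Ideal (TensorAlgebra k V) :=
  (TwoSidedIdeal.span (S : Set (TensorAlgebra k V))).asIdeal

instance (S : Submodule k (TensorAlgebra k V)) : (relIdeal S).IsTwoSided :=
  inferInstanceAs (TwoSidedIdeal.asIdeal _).IsTwoSided

/-- The quotient algebra `T(V) / I(S)`. -/
abbrev QuotAlg (S : Submodule k (TensorAlgebra k V)) : Type _ := TensorAlgebra k V ⧸ relIdeal S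

/-- The filtration of `T(V) / I(S)`: the image of the filtration of the tensor algebra. -/
def quotFilt (S : Submodule k (TensorAlgebra k V)) (m : ℕ) : Submodule k (QuotAlg S) :=
  (tensorFilt k V m).map (Ideal.Quotient.mkₐ k (relIdeal S)).toLinearMap

instance quotFilt_isRingFiltration (S : Submodule k (TensorAlgebra k V)) :
    IsRingFiltration (quotFilt S) (filtPred (quotFilt S)) :=
  isRingFiltration_of _ (fun _ _ h => Submodule.map_mono (tensorFilt_mono k V h))
    ⟨1, tensorDeg_le_tensorFilt k V le_rfl (by
      rw [tensorDeg, pow_zero]; exact Submodule.one_le.mp le_rfl),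
      map_one (Ideal.Quotient.mkₐ k (relIdeal S))⟩
    (by
      rintro i j _ _ ⟨a, ha, rfl⟩ ⟨b, hb, rfl⟩
      exact ⟨a * b, tensorFilt_mul_le k V i j (Submodule.mul_mem_mul ha hb),
        map_mul (Ideal.Quotient.mkₐ k (relIdeal S)) a b⟩)

theorem mk_mem_quotFilt (S : Submodule k (TensorAlgebra k V)) {m : ℕ} {a : TensorAlgebra k V}
    (ha : a ∈ tensorFilt k V m) : Ideal.Quotient.mkₐ k (relIdeal S) a ∈ quotFilt S m :=
  ⟨a, ha, rfl⟩

theorem ι_mem_tensorDeg (v : V) : TensorAlgebra.ι k v ∈ tensorDeg k V 1 := by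
  rw [tensorDeg, pow_one]
  exact LinearMap.mem_range_self _ v

/-- The linear map `V^{⊗ i} → gr_i(T(V) / I(S))` taking a tensor to the class of its image. -/
def degToGr (S : Submodule k (TensorAlgebra k V)) (i : ℕ) :
    tensorDeg k V i →ₗ[k] GrPiece (quotFilt S) i :=
  grMk (quotFilt S) i ∘ₗ
    ((Ideal.Quotient.mkₐ k (relIdeal S)).toLinearMap ∘ₗ (tensorDeg k V i).subtype).codRestrict _
      (fun a => mk_mem_quotFilt S (tensorDeg_le_tensorFilt k V le_rfl a.2))

theorem degToGr_apply (S : Submodule k (TensorAlgebra k V)) (i : ℕ) (a : tensorDeg k V i) :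
    degToGr S i a = grMk (quotFilt S) i ⟨Ideal.Quotient.mkₐ k (relIdeal S) a,
      mk_mem_quotFilt S (tensorDeg_le_tensorFilt k V le_rfl a.2)⟩ :=
  rfl

/-- The algebra morphism `T(V) → gr(T(V) / I(S))` extending `V → gr_1`. -/
def tensorToGr (S : Submodule k (TensorAlgebra k V)) :
    TensorAlgebra k V →ₐ[k] AssocGraded (quotFilt S) :=
  TensorAlgebra.lift k
    (DirectSum.lof k ℕ (GrPiece (quotFilt S)) 1 ∘ₗ degToGr S 1 ∘ₗ
      (TensorAlgebra.ι k).codRestrict (tensorDeg k V 1) ι_mem_tensorDeg)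

/-- `tensorToGr` takes a homogeneous tensor of degree `i` to the class in `gr_i` of its image. -/
theorem tensorToGr_of_mem (S : Submodule k (TensorAlgebra k V)) {i : ℕ} {a : TensorAlgebra k V}
    (ha : a ∈ tensorDeg k V i) :
    tensorToGr S a = DirectSum.of (GrPiece (quotFilt S)) i (degToGr S i ⟨a, ha⟩) := by
  unfold tensorDeg at ha
  induction ha using Submodule.pow_induction_on_left' with
  | algebraMap r =>
    rw [AlgHom.commutes, DirectSum.algebraMap_apply]
    rfl
  | add x y i hx hy ihx ihy =>
    rw [map_add, ihx, ihy, ← map_add, ← map_add]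
    rfl
  | mem_mul m hm i x hx ih =>
    obtain ⟨v, rfl⟩ := hm
    rw [map_mul, ih, tensorToGr, TensorAlgebra.lift_ι_apply]
    simp only [LinearMap.comp_apply, DirectSum.lof_eq_of]
    rw [DirectSum.of_mul_of]
    exact DirectSum.of_eq_of_gradedMonoid_eq
      (gradedMonoid_mk_grMk _ (add_comm 1 i)
        (map_mul (Ideal.Quotient.mkₐ k (relIdeal S)) (TensorAlgebra.ι k v) x).symm)

end Tensor

/-! ### PBW deformations -/

section Deformation

variable {k V : Type*} [Field k] [AddCommGroup V] [Module k V]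

/-- The subspace `P = (Id - φ)(R)` of the tensor algebra. -/
def deformedRel {R : Submodule k (TensorAlgebra k V)} {m : ℕ} (φ : R →ₗ[k] tensorFilt k V m) :
    Submodule k (TensorAlgebra k V) :=
  LinearMap.range (R.subtype - (tensorFilt k V m).subtype ∘ₗ φ)

/-- The morphism `T(V) → gr(U)`, `U = T(V) / I(P)`, vanishes on `R`. -/
theorem tensorToGr_rel {N : ℕ} (hN : 2 ≤ N) {R : Submodule k (TensorAlgebra k V)}
    (hR : R ≤ tensorDeg k V N) (φ : R →ₗ[k] tensorFilt k V (N - 1))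
    {a : TensorAlgebra k V} (ha : a ∈ R) : tensorToGr (deformedRel φ) a = 0 := by
  rw [tensorToGr_of_mem _ (hR ha), degToGr_apply]
  have h : grMk (quotFilt (deformedRel φ)) N ⟨Ideal.Quotient.mkₐ k (relIdeal (deformedRel φ)) a,
      mk_mem_quotFilt _ (tensorDeg_le_tensorFilt k V le_rfl (hR ha))⟩ = 0 := by
    rw [grMk_eq_zero]
    obtain ⟨M, rfl⟩ : ∃ M, N = M + 1 := ⟨N - 1, by omega⟩
    refine ⟨φ ⟨a, ha⟩, (φ ⟨a, ha⟩).2, Eq.symm ?_⟩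
    refine (Ideal.Quotient.eq).mpr ?_
    exact TwoSidedIdeal.subset_span ⟨⟨a, ha⟩, rfl⟩
  rw [h, map_zero]

/-- The natural graded algebra morphism `p : A → gr(U)`, where `A = T(V) / I(R)` with
`R ⊆ V^{⊗ N}` and `U = T(V) / I(P)` with `P = (Id - φ)(R)`. It takes the class in `A` of a
homogeneous tensor of degree `i` to the class in `gr_i(U)` of its image in `U`. -/
def pbwMap {N : ℕ} (hN : 2 ≤ N) {R : Submodule k (TensorAlgebra k V)}
    (hR : R ≤ tensorDeg k V N) (φ : R →ₗ[k] tensorFilt k V (N - 1)) :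
    QuotAlg R →ₐ[k] AssocGraded (quotFilt (deformedRel φ)) :=
  Ideal.Quotient.liftₐ (relIdeal R) (tensorToGr (deformedRel φ)) (by
    intro a ha
    have hle : TwoSidedIdeal.span (R : Set (TensorAlgebra k V)) ≤
        TwoSidedIdeal.ker (tensorToGr (deformedRel φ)) :=
      TwoSidedIdeal.span_le.mpr fun b hb =>
        (TwoSidedIdeal.mem_ker _).mpr (tensorToGr_rel hN hR φ hb)
    exact (TwoSidedIdeal.mem_ker _).mp (hle ha))

theorem pbwMap_mk {N : ℕ} (hN : 2 ≤ N) {R : Submodule k (TensorAlgebra k V)}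
    (hR : R ≤ tensorDeg k V N) (φ : R →ₗ[k] tensorFilt k V (N - 1))
    {i : ℕ} {a : TensorAlgebra k V} (ha : a ∈ tensorDeg k V i) :
    pbwMap hN hR φ (Ideal.Quotient.mkₐ k (relIdeal R) a) =
      DirectSum.of (GrPiece (quotFilt (deformedRel φ))) i
        (grMk _ i ⟨Ideal.Quotient.mkₐ k (relIdeal (deformedRel φ)) a,
          mk_mem_quotFilt _ (tensorDeg_le_tensorFilt k V le_rfl ha)⟩) :=
  tensorToGr_of_mem _ ha

/-- The filtered algebra `U = T(V) / I(P)`, `P = (Id - φ)(R)`, is a PBW deformation of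
`A = T(V) / I(R)`: the natural graded algebra morphism `p : A → gr(U)` is an isomorphism. -/
def IsPBWDeformation {N : ℕ} (hN : 2 ≤ N) {R : Submodule k (TensorAlgebra k V)}
    (hR : R ≤ tensorDeg k V N) (φ : R →ₗ[k] tensorFilt k V (N - 1)) : Prop :=
  Function.Bijective (pbwMap hN hR φ)

/-- The one-dimensional space of relations `R = k v^N`. -/
def powRel (k : Type*) {V : Type*} [Field k] [AddCommGroup V] [Module k V] (v : V) (N : ℕ) :
    Submodule k (TensorAlgebra k V) :=
  Submodule.span k {TensorAlgebra.ι k v ^ N}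

theorem pow_mem_powRel (v : V) (N : ℕ) : TensorAlgebra.ι k v ^ N ∈ powRel k v N :=
  Submodule.mem_span_singleton_self _

theorem powRel_le (v : V) (N : ℕ) : powRel k v N ≤ tensorDeg k V N :=
  (Submodule.span_singleton_le_iff_mem _ _).mpr
    (Submodule.pow_mem_pow _ (LinearMap.mem_range_self _ v) N)

end Deformation

end PBW

end

open scoped DirectSum

/-! Write X for x_1 and f for φ(X^N). The map p is always onto, and it is injective exactly when
every homogeneous a congruent modulo I(P) to a tensor of lower filtration already lies in I(R)
(`isPBWDeformation_iff`). The ideal I(R) is spanned by the words containing X^N as a factor, so the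
condition concerns the rewriting rule X^N → f, whose only obstruction is the overlap of X^N with
itself.

Necessity: X·X^N = X^N·X puts the commutator fX - Xf in I(P), and its filtration degree is at most
N. If it is nonzero, its top component lies in I(R), hence is a multiple of X^N; but X^N never
occurs in fX - Xf. So f commutes with X (`commute_of_leading_mem`), and the centralizer of X in the
free algebra is k[X] (`exists_aeval_of_commute`).

Sufficiency: if f = q(X), rewriting makes the letters act on the space of words. The relation holds
on the orbit of the empty word because q(X) commutes with X (`reduceAct_pow_succ_sub_aeval`), so
I(P) kills the empty word. Words without factor X^N are sent to themselves, while the others give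
only strictly shorter words. Reading off coefficients of top length gives the criterion
(`leading_mem_relIdeal_powRel`). -/

namespace PBW

/-! ### Words as a basis of the tensor algebra, and letters acting on words. -/

section Words

variable {k V ι : Type*} [Field k] [AddCommGroup V] [Module k V] (x : Module.Basis ι k V)

/-- The noncommutative monomial in the basis vectors spelled by a list of indices. -/
noncomputable def word (w : List ι) : TensorAlgebra k V :=
  (w.map fun i => TensorAlgebra.ι k (x i)).prod

theorem word_nil : word x [] = 1 := rfl

theorem word_cons (i : ι) (w : List ι) : word x (i :: w) = TensorAlgebra.ι k (x i) * word x w :=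
  List.prod_cons

theorem word_append (u w : List ι) : word x (u ++ w) = word x u * word x w := by
  simp [word]

theorem word_replicate (i : ι) (m : ℕ) :
    word x (List.replicate m i) = TensorAlgebra.ι k (x i) ^ m := by
  simp [word]

theorem word_mem_tensorDeg (w : List ι) : word x w ∈ tensorDeg k V w.length := by
  induction w with
  | nil => exact Submodule.one_le.mp le_rfl
  | cons i w ih =>
    rw [word_cons, List.length_cons, tensorDeg, pow_succ']
    exact Submodule.mul_mem_mul (LinearMap.mem_range_self _ _) ih

@[elab_as_elim]
theorem basis_induction {C : V → Prop} (h0 : C 0) (hadd : ∀ a b, C a → C b → C (a + b))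
    (hsmul : ∀ (c : k) i, C (c • x i)) (v : V) : C v := by
  rw [← x.linearCombination_repr v]
  induction x.repr v using Finsupp.induction_linear with
  | zero => rwa [map_zero]
  | add a b ha hb => rw [map_add]; exact hadd _ _ ha hb
  | single i c => rw [Finsupp.linearCombination_single]; exact hsmul c i

/-- The representation of the tensor algebra on the space with basis the words in which the
basis vectors act by prescribed operators. -/
noncomputable def wordRep (act : ι → Module.End k (List ι →₀ k)) :
    TensorAlgebra k V →ₐ[k] Module.End k (List ι →₀ k) :=
  TensorAlgebra.lift k (x.constr k act)

theorem wordRep_ι (act : ι → Module.End k (List ι →₀ k)) (i : ι) :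
    wordRep x act (TensorAlgebra.ι k (x i)) = act i := by
  rw [wordRep, TensorAlgebra.lift_ι_apply, Module.Basis.constr_basis]

/-- The image of the empty word under the action of an element of the tensor algebra. -/
noncomputable def orbitMap (act : ι → Module.End k (List ι →₀ k)) :
    TensorAlgebra k V →ₗ[k] List ι →₀ k :=
  LinearMap.applyₗ (Finsupp.single [] 1) ∘ₗ (wordRep x act).toLinearMap

theorem orbitMap_apply (act : ι → Module.End k (List ι →₀ k)) (t : TensorAlgebra k V) :
    orbitMap x act t = wordRep x act t (Finsupp.single [] 1) := rfl

theorem orbitMap_mul (act : ι → Module.End k (List ι →₀ k)) (s t : TensorAlgebra k V) :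
    orbitMap x act (s * t) = wordRep x act s (orbitMap x act t) := by
  simp [orbitMap_apply]

theorem orbitMap_word_cons (act : ι → Module.End k (List ι →₀ k)) (i : ι) (w : List ι) :
    orbitMap x act (word x (i :: w)) = act i (orbitMap x act (word x w)) := by
  rw [word_cons, orbitMap_mul, wordRep_ι]

theorem wordRep_ι_mem {act : ι → Module.End k (List ι →₀ k)} {S S' : Submodule k (List ι →₀ k)}
    (h : ∀ i, ∀ m ∈ S, act i m ∈ S') (v : V) {m : List ι →₀ k} (hm : m ∈ S) :
    wordRep x act (TensorAlgebra.ι k v) m ∈ S' := by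
  induction v using basis_induction x with
  | h0 => simp
  | hadd a b ha hb => rw [map_add, map_add]; exact S'.add_mem ha hb
  | hsmul c i =>
    rw [map_smul, map_smul, wordRep_ι]; exact S'.smul_mem _ (h i m hm)

/-- Each letter advances the index of `S` by one. Different choices of `S` yield the grading by
length, the bound on length, and (with `S` constant) an invariant subspace. -/
theorem orbitMap_mem_of_mem_tensorDeg {act : ι → Module.End k (List ι →₀ k)}
    {S : ℕ → Submodule k (List ι →₀ k)} (h0 : Finsupp.single [] 1 ∈ S 0)
    (h : ∀ i d, ∀ m ∈ S d, act i m ∈ S (d + 1)) {d : ℕ} {t : TensorAlgebra k V}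
    (ht : t ∈ tensorDeg k V d) : orbitMap x act t ∈ S d := by
  unfold tensorDeg at ht
  induction ht using Submodule.pow_induction_on_left' with
  | algebraMap r =>
    rw [orbitMap_apply, AlgHom.commutes, Module.algebraMap_end_apply]
    exact (S 0).smul_mem _ h0
  | add a b i ha hb iha ihb => rw [map_add]; exact (S i).add_mem iha ihb
  | mem_mul m hm i t ht ih =>
    obtain ⟨v, rfl⟩ := hm
    rw [orbitMap_mul]
    exact wordRep_ι_mem x (fun j => h j i) v ih

/-- The coordinates of a tensor with respect to the words. -/
noncomputable def coef : TensorAlgebra k V →ₗ[k] List ι →₀ k :=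
  orbitMap x fun i => Finsupp.lmapDomain k k (List.cons i)

theorem coef_ι_mul (i : ι) (t : TensorAlgebra k V) :
    coef x (TensorAlgebra.ι k (x i) * t) = (coef x t).mapDomain (List.cons i) := by
  rw [coef, orbitMap_mul, wordRep_ι]; rfl

theorem coef_word (w : List ι) : coef x (word x w) = Finsupp.single w 1 := by
  induction w with
  | nil => simp [coef, orbitMap_apply, word_nil]
  | cons i w ih => rw [word_cons, coef_ι_mul, ih, Finsupp.mapDomain_single]

/-- Spelling out words intertwines prefixing letters with left multiplication. Evaluated at the
empty word, this shows that a tensor is recovered from `coef`. -/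
theorem linearCombination_wordRep (t : TensorAlgebra k V) (m : List ι →₀ k) :
    Finsupp.linearCombination k (word x)
      (wordRep x (fun i => Finsupp.lmapDomain k k (List.cons i)) t m) =
    t * Finsupp.linearCombination k (word x) m := by
  induction t using TensorAlgebra.induction generalizing m with
  | algebraMap r =>
    rw [AlgHom.commutes, Module.algebraMap_end_apply, map_smul, Algebra.smul_def]
  | ι v =>
    induction v using basis_induction x with
    | h0 => simp
    | hadd a b ha hb => simp only [map_add, LinearMap.add_apply, add_mul, ha, hb]
    | hsmul c i =>
      simp only [map_smul, LinearMap.smul_apply, smul_mul_assoc, wordRep_ι]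
      congr 1
      induction m using Finsupp.induction_linear with
      | zero => simp
      | add a b ha hb => simp only [map_add, mul_add, ha, hb]
      | single w c =>
        simp [Finsupp.mapDomain_single, word_cons]
  | mul a b ha hb => rw [map_mul, Module.End.mul_apply, ha, hb, mul_assoc]
  | add a b ha hb => rw [map_add, LinearMap.add_apply, map_add, ha, hb, add_mul]

theorem linearCombination_coef (t : TensorAlgebra k V) :
    Finsupp.linearCombination k (word x) (coef x t) = t := by
  rw [coef, orbitMap_apply, linearCombination_wordRep]
  simp [word_nil]

theorem coef_injective : Function.Injective (coef x) :=
  Function.LeftInverse.injective (linearCombination_coef x)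

theorem coef_linearCombination (c : List ι →₀ k) :
    coef x (Finsupp.linearCombination k (word x) c) = c := by
  induction c using Finsupp.induction_linear with
  | zero => simp
  | add a b ha hb => simp only [map_add, ha, hb]
  | single w c => simp [coef_word]

/-- To check an inclusion of a tensor in a subspace it suffices to look at its words. -/
theorem mem_of_word_mem {S : Submodule k (TensorAlgebra k V)} {t : TensorAlgebra k V}
    (h : ∀ w, coef x t w ≠ 0 → word x w ∈ S) : t ∈ S := by
  rw [← linearCombination_coef x t, Finsupp.linearCombination_apply]
  exact S.sum_mem fun w hw => S.smul_mem _ (h w (Finsupp.mem_support_iff.mp hw))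

@[elab_as_elim]
theorem word_induction {C : TensorAlgebra k V → Prop} (hw : ∀ w, C (word x w)) (h0 : C 0)
    (hadd : ∀ a b, C a → C b → C (a + b)) (hsmul : ∀ (c : k) a, C a → C (c • a))
    (t : TensorAlgebra k V) : C t :=
  mem_of_word_mem x (S := ⟨⟨⟨{t | C t}, hadd _ _⟩, h0⟩, hsmul⟩) fun w _ => hw w

theorem coef_mul_ι (i : ι) (t : TensorAlgebra k V) :
    coef x (t * TensorAlgebra.ι k (x i)) = (coef x t).mapDomain (· ++ [i]) := by
  induction t using word_induction x with
  | hw w =>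
    rw [← pow_one (TensorAlgebra.ι k (x i)), ← word_replicate, ← word_append, coef_word, coef_word,
      Finsupp.mapDomain_single, List.replicate_one]
  | h0 => simp
  | hadd a b ha hb => rw [add_mul, map_add, ha, hb, map_add, Finsupp.mapDomain_add]
  | hsmul c a ha => rw [smul_mul_assoc, map_smul, ha, map_smul, Finsupp.mapDomain_smul]

theorem coef_mem_supported_of_mem_tensorDeg {d : ℕ} {t : TensorAlgebra k V}
    (ht : t ∈ tensorDeg k V d) : coef x t ∈ Finsupp.supported k k {w : List ι | w.length = d} := by
  refine orbitMap_mem_of_mem_tensorDeg x (S := fun d => Finsupp.supported k k {w | w.length = d})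
    (Finsupp.single_mem_supported k _ rfl) (fun i d m hm => ?_) ht
  refine Finsupp.supported_comap_lmapDomain k k _ _ (Finsupp.supported_mono ?_ hm)
  rintro w rfl
  rfl

theorem length_eq_of_mem_tensorDeg {d : ℕ} {t : TensorAlgebra k V} (ht : t ∈ tensorDeg k V d)
    {w : List ι} (hw : coef x t w ≠ 0) : w.length = d :=
  coef_mem_supported_of_mem_tensorDeg x ht (Finsupp.mem_support_iff.mpr hw)

theorem length_le_of_mem_tensorFilt {d : ℕ} {t : TensorAlgebra k V} (ht : t ∈ tensorFilt k V d)
    {w : List ι} (hw : coef x t w ≠ 0) : w.length ≤ d := by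
  have h : tensorFilt k V d ≤
      (Finsupp.supported k k {w : List ι | w.length ≤ d}).comap (coef x) :=
    iSup_le fun i t ht => Finsupp.supported_mono
      (fun w hw => (Set.mem_ofPred.mp hw).le.trans (Nat.lt_succ_iff.mp i.2))
      (coef_mem_supported_of_mem_tensorDeg x ht)
  exact h ht (Finsupp.mem_support_iff.mpr hw)

theorem mem_filtPred_tensorFilt {d : ℕ} {t : TensorAlgebra k V}
    (h : ∀ w, coef x t w ≠ 0 → w.length < d) : t ∈ filtPred (tensorFilt k V) d := by
  refine mem_of_word_mem x fun w hw => ?_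
  have := h w hw
  obtain _ | d := d
  · exact absurd this (Nat.not_lt_zero _)
  · exact tensorDeg_le_tensorFilt k V (Nat.lt_succ_iff.mp this) (word_mem_tensorDeg x w)

end Words

/-! ### Reduction of the PBW property to a statement about leading terms. -/

section Reduction

variable {k V : Type*} [Field k] [AddCommGroup V] [Module k V]

theorem exists_sub_mem_filtPred {i : ℕ} {t : TensorAlgebra k V} (ht : t ∈ tensorFilt k V i) :
    ∃ h ∈ tensorDeg k V i, t - h ∈ filtPred (tensorFilt k V) i := by
  have : tensorFilt k V i ≤ tensorDeg k V i ⊔ filtPred (tensorFilt k V) i := by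
    refine iSup_le fun j => ?_
    obtain h | h := (Nat.lt_succ_iff.mp j.2).eq_or_lt
    · rw [h]; exact le_sup_left
    · refine le_trans ?_ le_sup_right
      obtain _ | i := i
      · exact absurd h (Nat.not_lt_zero _)
      · exact tensorDeg_le_tensorFilt k V (Nat.lt_succ_iff.mp h)
  obtain ⟨a, ha, b, hb, rfl⟩ := Submodule.mem_sup.mp (this ht)
  exact ⟨a, ha, by rwa [add_sub_cancel_left]⟩

theorem mk_mem_filtPred_quotFilt {S : Submodule k (TensorAlgebra k V)} {i : ℕ}
    {u : QuotAlg S} : u ∈ filtPred (quotFilt S) i ↔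
      ∃ b ∈ filtPred (tensorFilt k V) i, Ideal.Quotient.mkₐ k (relIdeal S) b = u := by
  cases i with
  | zero =>
    constructor
    · rintro h
      exact ⟨0, Submodule.zero_mem _, (map_zero _).trans ((Submodule.mem_bot k).mp h).symm⟩
    · rintro ⟨b, hb, rfl⟩
      rw [(Submodule.mem_bot k).mp hb, map_zero]
      exact Submodule.zero_mem _
  | succ i => exact Iff.rfl

/-- A symbol of degree i depends only on the degree-i component of a lift, so it comes from a
homogeneous tensor. -/
theorem tensorToGr_surjective (S : Submodule k (TensorAlgebra k V)) :
    Function.Surjective (tensorToGr S) := by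
  intro y
  induction y using DirectSum.induction_on with
  | zero => exact ⟨0, map_zero _⟩
  | add a b ha hb =>
    obtain ⟨a, rfl⟩ := ha
    obtain ⟨b, rfl⟩ := hb
    exact ⟨a + b, map_add _ _ _⟩
  | of i y =>
    obtain ⟨⟨_, t, ht, rfl⟩, rfl⟩ := grMk_surjective _ i y
    obtain ⟨h, hh, hth⟩ := exists_sub_mem_filtPred ht
    refine ⟨h, ?_⟩
    rw [tensorToGr_of_mem S hh, degToGr_apply, eq_comm, ← sub_eq_zero, ← map_sub, ← map_sub]
    rw [(grMk_eq_zero (quotFilt S)).mpr, map_zero]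
    exact mk_mem_filtPred_quotFilt.mpr ⟨_, hth, map_sub _ _ _⟩

-- Only injectivity is at stake. A tensor killed in gr(U) has all its homogeneous components killed,
-- and a component of degree i dies exactly when its image in U comes from lower filtration.
open Classical in
theorem isPBWDeformation_iff {N : ℕ} (hN : 2 ≤ N) {R : Submodule k (TensorAlgebra k V)}
    (hR : R ≤ tensorDeg k V N) (φ : R →ₗ[k] tensorFilt k V (N - 1)) :
    IsPBWDeformation hN hR φ ↔ ∀ i, ∀ a ∈ tensorDeg k V i, ∀ b ∈ filtPred (tensorFilt k V) i,
      a - b ∈ relIdeal (deformedRel φ) → a ∈ relIdeal R := by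
  constructor
  · intro h i a ha b hb hab
    have h0 : pbwMap hN hR φ (Ideal.Quotient.mkₐ k (relIdeal R) a) = 0 := by
      refine (pbwMap_mk hN hR φ ha).trans ((congrArg _ ((grMk_eq_zero _).mpr ?_)).trans (map_zero _))
      exact mk_mem_filtPred_quotFilt.mpr ⟨b, hb, (Ideal.Quotient.eq.mpr hab).symm⟩
    exact Ideal.Quotient.eq_zero_iff_mem.mp (h.1 (h0.trans (map_zero _).symm))
  · intro h
    refine ⟨(injective_iff_map_eq_zero _).mpr fun u hu => ?_, fun y => ?_⟩
    · obtain ⟨a, rfl⟩ := Ideal.Quotient.mk_surjective u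
      refine Ideal.Quotient.eq_zero_iff_mem.mpr ?_
      replace hu : tensorToGr (deformedRel φ) a = 0 := hu
      let 𝒜 : ℕ → Submodule k (TensorAlgebra k V) := fun i =>
        LinearMap.range (TensorAlgebra.ι k : V →ₗ[k] TensorAlgebra k V) ^ i
      have hsum := DirectSum.sum_support_decompose 𝒜 a
      rw [← hsum]
      refine Ideal.sum_mem _ fun i hi => ?_
      have hmem (j : ℕ) : (DirectSum.decompose 𝒜 a j : TensorAlgebra k V) ∈ tensorDeg k V j :=
        (DirectSum.decompose 𝒜 a j).2
      have h0 : degToGr (deformedRel φ) i ⟨DirectSum.decompose 𝒜 a i, hmem i⟩ = 0 := by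
        rw [← hsum, map_sum, Finset.sum_congr rfl fun j _ =>
          tensorToGr_of_mem (deformedRel φ) (hmem j)] at hu
        -- Projecting to gr_i keeps only the component of degree i.
        have := congrArg (fun y => y i) hu
        simp only [DirectSum.sum_apply] at this
        rwa [Finset.sum_eq_single_of_mem i hi fun j _ hj => DirectSum.of_eq_of_ne _ _ _ hj.symm,
          DirectSum.of_eq_same] at this
      rw [degToGr_apply, grMk_eq_zero] at h0
      obtain ⟨b, hb, hab⟩ := mk_mem_filtPred_quotFilt.mp h0
      exact h i _ (hmem i) b hb (Ideal.Quotient.eq.mp hab.symm)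
    · obtain ⟨a, rfl⟩ := tensorToGr_surjective _ y
      exact ⟨Ideal.Quotient.mk _ a, rfl⟩

end Reduction

end PBW

namespace PBW

/-! ### The monomial ideal I(R) and the generator of P. -/

section Relations

variable {k V ι : Type*} [Field k] [AddCommGroup V] [Module k V] (x : Module.Basis ι k V)

/-- The span of the words with factor i^N contains the generator and is stable under multiplication
by words on both sides, so it contains the whole ideal. -/
theorem isInfix_of_mem_relIdeal_powRel {i : ι} {N : ℕ} {t : TensorAlgebra k V}
    (ht : t ∈ relIdeal (powRel k (x i) N)) {w : List ι} (hw : coef x t w ≠ 0) :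
    List.replicate N i <:+: w := by
  let S := (Finsupp.supported k k {w : List ι | List.replicate N i <:+: w}).comap (coef x)
  have hword {w : List ι} (h : List.replicate N i <:+: w) : word x w ∈ S := by
    change coef x (word x w) ∈ Finsupp.supported k k _
    rw [coef_word]
    exact Finsupp.single_mem_supported k _ h
  have hbad {t : TensorAlgebra k V} (ht : t ∈ S) {w : List ι} (hw : coef x t w ≠ 0) :
      List.replicate N i <:+: w := ht (Finsupp.mem_support_iff.mpr hw)
  refine hbad (t := t) ?_ hw
  clear hw
  induction ht using TwoSidedIdeal.span_induction with
  | mem a h =>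
    obtain ⟨c, rfl⟩ := Submodule.mem_span_singleton.mp h
    rw [← word_replicate]
    exact S.smul_mem _ (hword List.infix_rfl)
  | zero => exact S.zero_mem
  | add a b _ _ ha hb => exact S.add_mem ha hb
  | neg a _ ha => exact S.neg_mem ha
  | left_absorb a t _ ht =>
    induction a using word_induction x with
    | hw u =>
      refine mem_of_word_mem x (S := S.comap (LinearMap.mulLeft k (word x u))) fun w hw => ?_
      change word x u * word x w ∈ S
      rw [← word_append]
      exact hword ((hbad ht hw).trans (List.suffix_append u w).isInfix)
    | h0 => rw [zero_mul]; exact S.zero_mem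
    | hadd a b ha hb => rw [add_mul]; exact S.add_mem ha hb
    | hsmul c a ha => rw [smul_mul_assoc]; exact S.smul_mem c ha
  | right_absorb a t _ ht =>
    induction a using word_induction x with
    | hw u =>
      refine mem_of_word_mem x (S := S.comap (LinearMap.mulRight k (word x u))) fun w hw => ?_
      change word x w * word x u ∈ S
      rw [← word_append]
      exact hword ((hbad ht hw).trans (List.prefix_append w u).isInfix)
    | h0 => rw [mul_zero]; exact S.zero_mem
    | hadd a b ha hb => rw [mul_add]; exact S.add_mem ha hb
    | hsmul c a ha => rw [mul_smul_comm]; exact S.smul_mem c ha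

theorem subset_relIdeal {S : Submodule k (TensorAlgebra k V)} {a : TensorAlgebra k V}
    (ha : a ∈ S) : a ∈ relIdeal S :=
  TwoSidedIdeal.subset_span ha

theorem word_mem_relIdeal_powRel {i : ι} {N : ℕ} {w : List ι}
    (hw : List.replicate N i <:+: w) : word x w ∈ relIdeal (powRel k (x i) N) := by
  obtain ⟨u, v, rfl⟩ := hw
  rw [word_append, word_append, word_replicate]
  exact Ideal.mul_mem_right _ _ (Ideal.mul_mem_left _ _ (subset_relIdeal (pow_mem_powRel _ _)))

theorem pow_sub_mem_relIdeal {v : V} {N m : ℕ}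
    (φ : powRel k v N →ₗ[k] tensorFilt k V m) :
    TensorAlgebra.ι k v ^ N - (φ ⟨TensorAlgebra.ι k v ^ N, pow_mem_powRel v N⟩ :
      TensorAlgebra k V) ∈ relIdeal (deformedRel φ) :=
  subset_relIdeal ⟨⟨_, pow_mem_powRel v N⟩, rfl⟩

theorem deformedRel_powRel {v : V} {N m : ℕ} (φ : powRel k v N →ₗ[k] tensorFilt k V m) :
    deformedRel φ = Submodule.span k {TensorAlgebra.ι k v ^ N -
      (φ ⟨TensorAlgebra.ι k v ^ N, pow_mem_powRel v N⟩ : TensorAlgebra k V)} := by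
  refine le_antisymm ?_ ((Submodule.span_singleton_le_iff_mem _ _).mpr
    ⟨⟨_, pow_mem_powRel v N⟩, rfl⟩)
  rintro _ ⟨⟨r, hr⟩, rfl⟩
  obtain ⟨c, rfl⟩ := Submodule.mem_span_singleton.mp hr
  refine Submodule.mem_span_singleton.mpr ⟨c, ?_⟩
  have : (⟨c • TensorAlgebra.ι k v ^ N, hr⟩ : powRel k v N) =
    c • ⟨TensorAlgebra.ι k v ^ N, pow_mem_powRel v N⟩ := rfl
  rw [this, map_smul]
  rfl

end Relations

/-! ### Necessity: the self-overlap of X^N and the centralizer of a generator. -/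

section Centralizer

variable {k V ι : Type*} [Field k] [AddCommGroup V] [Module k V] (x : Module.Basis ι k V)

theorem eq_replicate_or_exists (i : ι) (w : List ι) :
    w = List.replicate w.length i ∨
      ∃ a j v, j ≠ i ∧ w = List.replicate a i ++ j :: v := by
  induction w with
  | nil => exact .inl rfl
  | cons l w ih =>
    by_cases hl : l = i
    · subst hl
      obtain h | ⟨a, j, v, hj, h⟩ := ih
      · exact .inl (by rw [List.length_cons, List.replicate_succ, ← h])
      · exact .inr ⟨a + 1, j, v, hj, by rw [h]; rfl⟩
    · exact .inr ⟨0, l, w, hl, rfl⟩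

theorem concat_injective (i : ι) : Function.Injective fun w : List ι => w ++ [i] :=
  List.append_left_injective [i]

theorem mapDomain_cons_apply_of_ne (c : List ι →₀ k) {i j : ι} (h : j ≠ i) (w : List ι) :
    c.mapDomain (List.cons i) (j :: w) = 0 :=
  Finsupp.mapDomain_of_notMem_range _ _ (by rintro ⟨v, hv⟩; exact h (List.cons.inj hv).1.symm)

theorem mapDomain_cons_apply (c : List ι →₀ k) (i : ι) (w : List ι) :
    c.mapDomain (List.cons i) (i :: w) = c w :=
  Finsupp.mapDomain_apply (List.cons_injective (a := i)) c w

theorem mapDomain_concat_apply (c : List ι →₀ k) (i : ι) (w : List ι) :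
    c.mapDomain (· ++ [i]) (w ++ [i]) = c w :=
  Finsupp.mapDomain_apply (concat_injective i) c w

/-- Comparing coefficients in tX = Xt shows that a leading i can be moved to the end of a word
without changing its coefficient. After a moves the word starts with j, and such a word followed by
i does not occur in Xt. -/
theorem coef_eq_zero_of_commute {i : ι} {t : TensorAlgebra k V}
    (h : Commute t (TensorAlgebra.ι k (x i))) {j : ι} (hj : j ≠ i) (a : ℕ) (v : List ι) :
    coef x t (List.replicate a i ++ j :: v) = 0 := by
  have key : (coef x t).mapDomain (· ++ [i]) = (coef x t).mapDomain (List.cons i) := by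
    rw [← coef_mul_ι, h.eq, coef_ι_mul]
  induction a generalizing v with
  | zero =>
    rw [← mapDomain_concat_apply _ i, key]
    exact mapDomain_cons_apply_of_ne _ hj _
  | succ a ih =>
    rw [← mapDomain_concat_apply _ i, key, List.replicate_succ, List.cons_append, List.cons_append,
      mapDomain_cons_apply, List.append_assoc]
    exact ih _

theorem exists_aeval_of_commute {i : ι} {t : TensorAlgebra k V}
    (h : Commute t (TensorAlgebra.ι k (x i))) :
    ∃ q : Polynomial k, t = Polynomial.aeval (TensorAlgebra.ι k (x i)) q := by
  suffices ht : t ∈ Subalgebra.toSubmodule (Algebra.adjoin k {TensorAlgebra.ι k (x i)}) by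
    rw [Subalgebra.mem_toSubmodule, Algebra.adjoin_singleton_eq_range_aeval] at ht
    exact ht.imp fun q hq => hq.symm
  refine mem_of_word_mem x fun w hw => ?_
  obtain h' | ⟨a, j, v, hj, rfl⟩ := eq_replicate_or_exists i w
  · rw [h', word_replicate]
    exact pow_mem (Algebra.self_mem_adjoin_singleton k _) _
  · exact absurd (coef_eq_zero_of_commute x h hj a v) hw

/-- Deleting the last or the first letter of i^m leaves the same word, so the two contributions
cancel. -/
theorem coef_commutator_replicate (i : ι) (t : TensorAlgebra k V) (m : ℕ) :
    coef x (t * TensorAlgebra.ι k (x i) - TensorAlgebra.ι k (x i) * t) (List.replicate m i) = 0 := by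
  rw [map_sub, coef_mul_ι, coef_ι_mul, Finsupp.sub_apply, sub_eq_zero]
  cases m with
  | zero =>
    rw [Finsupp.mapDomain_of_notMem_range, Finsupp.mapDomain_of_notMem_range] <;> rintro ⟨v, hv⟩ <;>
      simp at hv
  | succ m =>
    conv_lhs => rw [List.replicate_succ', mapDomain_concat_apply]
    rw [List.replicate_succ, mapDomain_cons_apply]

theorem commute_of_leading_mem {i : ι} {N : ℕ} (hN : 1 ≤ N) {I : Ideal (TensorAlgebra k V)}
    [I.IsTwoSided] {f : TensorAlgebra k V} (hf : f ∈ tensorFilt k V (N - 1))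
    (hfI : TensorAlgebra.ι k (x i) ^ N - f ∈ I)
    (h : ∀ d, ∀ a ∈ tensorDeg k V d, ∀ b ∈ filtPred (tensorFilt k V) d,
      a - b ∈ I → a ∈ relIdeal (powRel k (x i) N)) :
    Commute f (TensorAlgebra.ι k (x i)) := by
  set X := TensorAlgebra.ι k (x i) with hX
  set g := f * X - X * f with hg
  have hgI : g ∈ I := by
    -- The overlap: X^(N+1) is reduced in two ways, and the difference is the commutator.
    have : g = X * (X ^ N - f) - (X ^ N - f) * X := by
      rw [hg, mul_sub, sub_mul, ← pow_succ, ← pow_succ']; abel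
    rw [this]
    exact I.sub_mem (I.mul_mem_left _ hfI) (I.mul_mem_right _ hfI)
  have hgN : g ∈ tensorFilt k V N := by
    have hXm : X ∈ tensorFilt k V 1 := tensorDeg_le_tensorFilt k V le_rfl (ι_mem_tensorDeg _)
    refine Submodule.sub_mem _ ?_ ?_
    · have := tensorFilt_mul_le k V _ _ (Submodule.mul_mem_mul hf hXm)
      rwa [Nat.sub_add_cancel hN] at this
    · have := tensorFilt_mul_le k V _ _ (Submodule.mul_mem_mul hXm hf)
      rwa [Nat.add_sub_cancel' hN] at this
  rw [commute_iff_eq, ← sub_eq_zero, ← hg]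
  by_contra hne
  have hsupp : (coef x g).support.Nonempty :=
    Finsupp.support_nonempty_iff.mpr fun h0 => hne (coef_injective x (h0.trans (map_zero _).symm))
  obtain ⟨w, hw, hmax⟩ := Finset.exists_max_image _ List.length hsupp
  -- The homogeneous component of g of top degree; the lower-order tensor fed to `h` is a - g, so
  -- that the difference is g itself.
  let a := Finsupp.linearCombination k (word x)
    ((coef x g).filter fun v => v.length = w.length)
  have hca : coef x a = (coef x g).filter fun v => v.length = w.length :=
    coef_linearCombination x _
  have ha : a ∈ tensorDeg k V w.length := by
    refine mem_of_word_mem x fun v hv => ?_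
    rw [hca] at hv
    have : v.length = w.length := by
      by_contra hl
      exact hv (Finsupp.filter_apply_neg (fun v : List ι => v.length = w.length) _ hl)
    rw [← this]
    exact word_mem_tensorDeg x v
  have hb : a - g ∈ filtPred (tensorFilt k V) w.length := by
    refine mem_filtPred_tensorFilt x fun v hv => ?_
    rw [map_sub, hca, Finsupp.sub_apply] at hv
    have hl : v.length ≠ w.length := fun hl => hv (by
      rw [Finsupp.filter_apply_pos (fun v : List ι => v.length = w.length) _ hl, sub_self])
    rw [Finsupp.filter_apply_neg (fun v : List ι => v.length = w.length) _ hl, zero_sub, neg_ne_zero] at hv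
    exact (hmax v (Finsupp.mem_support_iff.mpr hv)).lt_of_ne hl
  have haR := h _ a ha _ hb (by rwa [sub_sub_cancel])
  have hwne : coef x g w ≠ 0 := Finsupp.mem_support_iff.mp hw
  have hinf : List.replicate N i <:+: w := isInfix_of_mem_relIdeal_powRel x haR (by
    rwa [hca, Finsupp.filter_apply_pos (fun v : List ι => v.length = w.length) _ rfl])
  -- A word of length at most N containing i^N must be i^N.
  have hwN := hinf.eq_of_length_le
    (by rw [List.length_replicate]; exact length_le_of_mem_tensorFilt x hgN hwne)
  exact hwne (hwN ▸ coef_commutator_replicate x i f N)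

end Centralizer

end PBW

namespace PBW

/-! ### Sufficiency: the action on normal words when f = q(X), with N = m + 1. -/

section NormalForm

variable {k V ι : Type*} [Field k] [AddCommGroup V] [Module k V] (x : Module.Basis ι k V)

open Classical in
/-- The left multiplication by a letter on normal words modulo `i ^ (m + 1) = q(i)`. -/
noncomputable def reduceCons (i : ι) (m : ℕ) (q : Polynomial k) (j : ι) (w : List ι) :
    List ι →₀ k :=
  if j = i ∧ List.replicate m i <+: w then
    ∑ l ∈ Finset.range (m + 1), Finsupp.single (List.replicate l i ++ w.drop m) (q.coeff l)
  else Finsupp.single (j :: w) 1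

/-- The operators by which the letters act on words modulo `i ^ (m + 1) = q(i)`. -/
noncomputable def reduceAct (i : ι) (m : ℕ) (q : Polynomial k) (j : ι) :
    Module.End k (List ι →₀ k) :=
  Finsupp.linearCombination k (reduceCons i m q j)

variable (i : ι) (m : ℕ) (q : Polynomial k)

theorem reduceAct_single (j : ι) (w : List ι) :
    reduceAct i m q j (Finsupp.single w 1) = reduceCons i m q j w := by
  rw [reduceAct, Finsupp.linearCombination_single, one_smul]

theorem reduceAct_mem {S S' : Set (List ι)} {j : ι}
    (h : ∀ w ∈ S, reduceCons i m q j w ∈ Finsupp.supported k k S') {c : List ι →₀ k}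
    (hc : c ∈ Finsupp.supported k k S) : reduceAct i m q j c ∈ Finsupp.supported k k S' := by
  rw [reduceAct, Finsupp.linearCombination_apply]
  exact Submodule.sum_mem _ fun w hw => Submodule.smul_mem _ _ (h w (hc hw))

theorem reduceCons_of_not {j : ι} {w : List ι} (h : ¬ (j = i ∧ List.replicate m i <+: w)) :
    reduceCons i m q j w = Finsupp.single (j :: w) 1 := if_neg h

theorem reduceCons_replicate_append (w : List ι) :
    reduceCons i m q i (List.replicate m i ++ w) =
      ∑ l ∈ Finset.range (m + 1), Finsupp.single (List.replicate l i ++ w) (q.coeff l) := by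
  rw [reduceCons, if_pos ⟨rfl, List.prefix_append _ _⟩, List.drop_left' List.length_replicate]

theorem reduceCons_mem_length_le {j : ι} {w : List ι} {d : ℕ} (hw : w.length ≤ d) :
    reduceCons i m q j w ∈ Finsupp.supported k k {v : List ι | v.length ≤ d + 1} := by
  by_cases h : j = i ∧ List.replicate m i <+: w
  · obtain ⟨rfl, v, rfl⟩ := h
    rw [reduceCons_replicate_append]
    refine Submodule.sum_mem _ fun l hl => Finsupp.single_mem_supported k _ ?_
    have := Finset.mem_range.mp hl
    simp only [List.length_append, List.length_replicate, Set.mem_ofPred] at hw ⊢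
    omega
  · rw [reduceCons_of_not i m q h]
    exact Finsupp.single_mem_supported k _ (Nat.succ_le_succ hw)

theorem orbitMap_reduceAct_of_mem_tensorFilt {d : ℕ} {t : TensorAlgebra k V}
    (ht : t ∈ tensorFilt k V d) :
    orbitMap x (reduceAct i m q) t ∈ Finsupp.supported k k {w : List ι | w.length ≤ d} := by
  have h : tensorFilt k V d ≤
      (Finsupp.supported k k {w : List ι | w.length ≤ d}).comap (orbitMap x (reduceAct i m q)) :=
    iSup_le fun l t ht => Finsupp.supported_mono
      (fun w hw => (Set.mem_ofPred.mp hw).trans (Nat.lt_succ_iff.mp l.2))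
      (orbitMap_mem_of_mem_tensorDeg x
        (S := fun d => Finsupp.supported k k {w : List ι | w.length ≤ d})
        (Finsupp.single_mem_supported k _ (Nat.le_refl 0))
        (fun j d c hc => reduceAct_mem i m q
          (fun w hw => reduceCons_mem_length_le i m q hw) hc) ht)
  exact h ht

theorem orbitMap_reduceAct_of_mem_filtPred {d : ℕ} {t : TensorAlgebra k V}
    (ht : t ∈ filtPred (tensorFilt k V) d) {w : List ι} (hw : d ≤ w.length) :
    orbitMap x (reduceAct i m q) t w = 0 := by
  cases d with
  | zero => rw [(Submodule.mem_bot k).mp ht, map_zero, Finsupp.zero_apply]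
  | succ d =>
    by_contra h
    have := orbitMap_reduceAct_of_mem_tensorFilt x i m q ht (Finsupp.mem_support_iff.mpr h)
    exact absurd hw (Nat.not_le.mpr (Nat.lt_succ_of_le this))

/-- The word is built letter by letter from the right, and no suffix ever triggers the rewriting
rule. -/
theorem orbitMap_reduceAct_word {w : List ι} (hw : ¬ List.replicate (m + 1) i <:+: w) :
    orbitMap x (reduceAct i m q) (word x w) = Finsupp.single w 1 := by
  induction w with
  | nil => simp [word_nil, orbitMap_apply]
  | cons j w ih =>
    rw [orbitMap_word_cons, ih fun h => hw (h.trans (List.suffix_cons j w).isInfix),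
      reduceAct_single, reduceCons_of_not]
    rintro ⟨rfl, v, rfl⟩
    exact hw (List.prefix_append (List.replicate (m + 1) j) v).isInfix

/-- The words with an initial run of `i` of length at most `m`. -/
def shortRun (i : ι) (m : ℕ) : Set (List ι) :=
  {w | ∃ a v, a ≤ m ∧ (∀ u, v ≠ i :: u) ∧ w = List.replicate a i ++ v}

theorem replicate_prefix_iff {a : ℕ} {v : List ι} (hv : ∀ u, v ≠ i :: u) :
    List.replicate m i <+: List.replicate a i ++ v ↔ m ≤ a := by
  constructor
  · intro h
    induction m generalizing a with
    | zero => exact Nat.zero_le _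
    | succ m ih =>
      cases a with
      | zero =>
        obtain ⟨u, hu⟩ := h
        exact absurd hu.symm (hv _)
      | succ a => exact Nat.succ_le_succ (ih ((List.cons_prefix_cons.mp h).2))
  · intro h
    obtain ⟨b, rfl⟩ := Nat.exists_eq_add_of_le h
    rw [List.replicate_add, List.append_assoc]
    exact List.prefix_append _ _

theorem reduceCons_mem_shortRun {j : ι} {w : List ι} (hw : w ∈ shortRun i m) :
    reduceCons i m q j w ∈ Finsupp.supported k k (shortRun i m) := by
  obtain ⟨a, v, ha, hv, rfl⟩ := hw
  by_cases hj : j = i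
  · subst hj
    obtain rfl | hlt := ha.eq_or_lt
    · rw [reduceCons_replicate_append]
      exact Submodule.sum_mem _ fun l hl => Finsupp.single_mem_supported k _
        ⟨l, v, Nat.lt_succ_iff.mp (Finset.mem_range.mp hl), hv, rfl⟩
    · rw [reduceCons_of_not]
      · exact Finsupp.single_mem_supported k _ ⟨a + 1, v, hlt, hv, rfl⟩
      · rw [replicate_prefix_iff j m hv]
        omega
  · rw [reduceCons_of_not i m q fun h => hj h.1]
    exact Finsupp.single_mem_supported k _
      ⟨0, _, Nat.zero_le _, fun u hu => hj (List.cons.inj hu).1, rfl⟩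

/-- Letters act only at the front of a word, so controlling the initial run suffices: this subspace
contains the orbit of the empty word, and the relation can be verified on it. -/
theorem orbitMap_reduceAct_mem_shortRun (t : TensorAlgebra k V) :
    orbitMap x (reduceAct i m q) t ∈ Finsupp.supported k k (shortRun i m) := by
  refine mem_of_word_mem x (S := (Finsupp.supported k k (shortRun i m)).comap
    (orbitMap x (reduceAct i m q))) fun w _ => ?_
  exact orbitMap_mem_of_mem_tensorDeg x
    (S := fun _ => Finsupp.supported k k (shortRun i m))
    (Finsupp.single_mem_supported k _ ⟨0, [], Nat.zero_le _, by simp, rfl⟩)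
    (fun j d c hc => reduceAct_mem i m q (fun w hw => reduceCons_mem_shortRun i m q hw) hc)
    (word_mem_tensorDeg x w)

theorem reduceAct_pow_single {a : ℕ} (ha : a ≤ m) {v : List ι} (hv : ∀ u, v ≠ i :: u) :
    (reduceAct i m q i ^ a) (Finsupp.single v 1) =
      Finsupp.single (List.replicate a i ++ v) 1 := by
  induction a with
  | zero => rfl
  | succ a ih =>
    rw [pow_succ', Module.End.mul_apply, ih (Nat.le_of_succ_le ha), reduceAct_single,
      reduceCons_of_not]
    · rfl
    · rw [replicate_prefix_iff i m hv]
      omega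

/-- With X acting through i, the word i^a v is X^a applied to v. The operator X^(m+1) - q(X)
commutes with X^a because q is a polynomial, so it is enough to treat v with no leading i; there
X·(i^m v) is q(X)v by construction. This is where the overlap is resolved. -/
theorem reduceAct_pow_succ_sub_aeval (hq : q.natDegree ≤ m) {c : List ι →₀ k}
    (hc : c ∈ Finsupp.supported k k (shortRun i m)) :
    (reduceAct i m q i ^ (m + 1) - Polynomial.aeval (reduceAct i m q i) q) c = 0 := by
  rw [Finsupp.supported_eq_span_single] at hc
  suffices h : Submodule.span k ((fun w => Finsupp.single w (1 : k)) '' shortRun i m) ≤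
      LinearMap.ker (reduceAct i m q i ^ (m + 1) - Polynomial.aeval (reduceAct i m q i) q) from
    h hc
  rw [Submodule.span_le]
  rintro _ ⟨_, ⟨a, v, ha, hv, rfl⟩, rfl⟩
  have hcomm : Commute (reduceAct i m q i ^ (m + 1) - Polynomial.aeval (reduceAct i m q i) q)
      (reduceAct i m q i ^ a) := by
    have := (Commute.all (Polynomial.X ^ (m + 1) - q) (Polynomial.X ^ a)).map
      (Polynomial.aeval (R := k) (reduceAct i m q i))
    rwa [map_sub, map_pow, map_pow, Polynomial.aeval_X] at this
  change (reduceAct i m q i ^ (m + 1) - Polynomial.aeval (reduceAct i m q i) q)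
    (Finsupp.single _ 1) = 0
  rw [← reduceAct_pow_single i m q ha hv, ← Module.End.mul_apply, hcomm.eq, Module.End.mul_apply]
  convert map_zero (reduceAct i m q i ^ a)
  -- The degree bound on q matches its full expansion with the sum in `reduceCons`, which stops at l
  -- = m.
  rw [LinearMap.sub_apply, pow_succ', Module.End.mul_apply,
    reduceAct_pow_single i m q le_rfl hv, reduceAct_single, reduceCons_replicate_append,
    Polynomial.aeval_eq_sum_range' (Nat.lt_succ_of_le hq), LinearMap.sum_apply, sub_eq_zero]
  refine Finset.sum_congr rfl fun l hl => ?_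
  rw [LinearMap.smul_apply,
    reduceAct_pow_single i m q (Nat.lt_succ_iff.mp (Finset.mem_range.mp hl)) hv,
    Finsupp.smul_single, smul_eq_mul, mul_one]

theorem orbitMap_reduceAct_of_mem_relIdeal (hq : q.natDegree ≤ m) {t : TensorAlgebra k V}
    (ht : t ∈ relIdeal (Submodule.span k {TensorAlgebra.ι k (x i) ^ (m + 1) -
      Polynomial.aeval (TensorAlgebra.ι k (x i)) q})) :
    orbitMap x (reduceAct i m q) t = 0 := by
  -- Killing the empty word alone is not stable under right multiplication; killing its whole orbit
  -- is.
  suffices h : ∀ s, orbitMap x (reduceAct i m q) (t * s) = 0 by simpa using h 1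
  induction ht using TwoSidedIdeal.span_induction with
  | mem a h =>
    intro s
    obtain ⟨c, rfl⟩ := Submodule.mem_span_singleton.mp h
    rw [smul_mul_assoc, map_smul, orbitMap_mul, map_sub, map_pow, ← Polynomial.aeval_algHom_apply,
      wordRep_ι, reduceAct_pow_succ_sub_aeval i m q hq (orbitMap_reduceAct_mem_shortRun x i m q s),
      smul_zero]
  | zero => intro s; rw [zero_mul, map_zero]
  | add a b _ _ ha hb => intro s; rw [add_mul, map_add, ha, hb, add_zero]
  | neg a _ ha => intro s; rw [neg_mul, map_neg, ha, neg_zero]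
  | left_absorb a t _ ht => intro s; rw [mul_assoc, orbitMap_mul, ht, map_zero]
  | right_absorb a t _ ht => intro s; rw [mul_assoc, ht]

/-- The powers of X are distinct words, so the coefficient of i^l in q(X) is that of q, and the
filtration bounds l. -/
theorem natDegree_le_of_aeval_mem_tensorFilt
    (h : Polynomial.aeval (TensorAlgebra.ι k (x i)) q ∈ tensorFilt k V m) : q.natDegree ≤ m := by
  refine Polynomial.natDegree_le_iff_coeff_eq_zero.mpr fun l hl => ?_
  have hc : coef x (Polynomial.aeval (TensorAlgebra.ι k (x i)) q) (List.replicate l i) =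
      q.coeff l := by
    clear h
    induction q using Polynomial.induction_on' with
    | add p q hp hq => rw [map_add, map_add, Finsupp.add_apply, hp, hq, Polynomial.coeff_add]
    | monomial n a =>
      rw [Polynomial.aeval_monomial, ← Algebra.smul_def, ← word_replicate, map_smul, coef_word,
        Finsupp.smul_single, smul_eq_mul, mul_one, Polynomial.coeff_monomial]
      split_ifs with hnl
      · rw [hnl, Finsupp.single_eq_same]
      · exact Finsupp.single_eq_of_ne fun he => hnl (by simpa using congrArg List.length he.symm)
  by_contra hne
  have := length_le_of_mem_tensorFilt x h (hc.trans_ne hne)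
  rw [List.length_replicate] at this
  omega

/-- Replacing one factor i^(m+1) by q(X) changes v only by an element of the ideal, which acts as
zero on the empty word, and lands in filtration degree v.length - 1. -/
theorem orbitMap_reduceAct_of_isInfix (hq : q.natDegree ≤ m)
    (hf : Polynomial.aeval (TensorAlgebra.ι k (x i)) q ∈ tensorFilt k V m) {v w : List ι}
    (hv : List.replicate (m + 1) i <:+: v) (hw : v.length ≤ w.length) :
    orbitMap x (reduceAct i m q) (word x v) w = 0 := by
  obtain ⟨a, b, rfl⟩ := hv
  set f := Polynomial.aeval (TensorAlgebra.ι k (x i)) q with hfq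
  have h0 : orbitMap x (reduceAct i m q)
      (word x a * (TensorAlgebra.ι k (x i) ^ (m + 1) - f) * word x b) = 0 :=
    orbitMap_reduceAct_of_mem_relIdeal x i m q hq (Ideal.mul_mem_right _ _
      (Ideal.mul_mem_left _ _ (subset_relIdeal (Submodule.mem_span_singleton_self _))))
  rw [mul_sub, sub_mul, map_sub, sub_eq_zero, ← word_replicate, ← word_append, ← word_append] at h0
  rw [h0]
  by_contra hne
  have hmem : word x a * f * word x b ∈ tensorFilt k V (a.length + m + b.length) :=
    tensorFilt_mul_le k V _ _ (Submodule.mul_mem_mul (tensorFilt_mul_le k V _ _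
      (Submodule.mul_mem_mul (tensorDeg_le_tensorFilt k V le_rfl (word_mem_tensorDeg x a)) hf))
      (tensorDeg_le_tensorFilt k V le_rfl (word_mem_tensorDeg x b)))
  have := orbitMap_reduceAct_of_mem_tensorFilt x i m q hmem (Finsupp.mem_support_iff.mpr hne)
  simp only [Set.mem_ofPred, List.length_append, List.length_replicate] at this hw
  omega

/-- Suppose a word w without factor i^(m+1) occurs in a. The coefficient of w in the orbit image of
a is its coefficient in a: other normal words go to themselves, and reducible ones yield only
shorter words. But a and b have the same image, and that of b contains no word of length d. -/
theorem leading_mem_relIdeal_powRel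
    (hf : Polynomial.aeval (TensorAlgebra.ι k (x i)) q ∈ tensorFilt k V m) {d : ℕ}
    {a b : TensorAlgebra k V} (ha : a ∈ tensorDeg k V d) (hb : b ∈ filtPred (tensorFilt k V) d)
    (hab : a - b ∈ relIdeal (Submodule.span k {TensorAlgebra.ι k (x i) ^ (m + 1) -
      Polynomial.aeval (TensorAlgebra.ι k (x i)) q})) :
    a ∈ relIdeal (powRel k (x i) (m + 1)) := by
  have hq := natDegree_le_of_aeval_mem_tensorFilt x i m q hf
  refine mem_of_word_mem x (S := (relIdeal (powRel k (x i) (m + 1))).restrictScalars k)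
    fun w hw => word_mem_relIdeal_powRel x ?_
  by_contra hbad
  have hwd := length_eq_of_mem_tensorDeg x ha hw
  have h0 := orbitMap_reduceAct_of_mem_relIdeal x i m q hq hab
  rw [map_sub, sub_eq_zero] at h0
  have h1 : orbitMap x (reduceAct i m q) a w = 0 := by
    rw [h0]; exact orbitMap_reduceAct_of_mem_filtPred x i m q hb hwd.ge
  rw [← linearCombination_coef x a, Finsupp.linearCombination_apply, Finsupp.sum, map_sum,
    Finsupp.finsetSum_apply, Finset.sum_eq_single_of_mem w (Finsupp.mem_support_iff.mpr hw),
    map_smul, orbitMap_reduceAct_word x i m q hbad, Finsupp.smul_apply, Finsupp.single_eq_same,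
    smul_eq_mul, mul_one] at h1
  · exact hw h1
  · intro v hv hvw
    rw [map_smul, Finsupp.smul_apply]
    by_cases hvb : List.replicate (m + 1) i <:+: v
    · rw [orbitMap_reduceAct_of_isInfix x i m q hq hf hvb, smul_zero]
      rw [hwd, length_eq_of_mem_tensorDeg x ha (Finsupp.mem_support_iff.mp hv)]
    · rw [orbitMap_reduceAct_word x i m q hvb, Finsupp.single_eq_of_ne hvw.symm, smul_zero]

end NormalForm

end PBW

theorem mainTheorem11 {k V : Type*} [Field k] [AddCommGroup V] [Module k V]
    {n : ℕ} (hn : 1 ≤ n) (x : Module.Basis (Fin n) k V) {N : ℕ} (hN : 2 ≤ N)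
    (φ : PBW.powRel k (x ⟨0, hn⟩) N →ₗ[k] PBW.tensorFilt k V (N - 1)) :
    PBW.IsPBWDeformation hN (PBW.powRel_le (x ⟨0, hn⟩) N) φ ↔
      ∃ q : Polynomial k,
        (φ ⟨TensorAlgebra.ι k (x ⟨0, hn⟩) ^ N, PBW.pow_mem_powRel (x ⟨0, hn⟩) N⟩ :
            TensorAlgebra k V) =
          Polynomial.aeval (TensorAlgebra.ι k (x ⟨0, hn⟩)) q := by
  rw [PBW.isPBWDeformation_iff]
  constructor
  · intro h
    exact PBW.exists_aeval_of_commute x (PBW.commute_of_leading_mem x (by omega)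
      (φ _).2 (PBW.pow_sub_mem_relIdeal φ) h)
  · rintro ⟨q, hq⟩ d a ha b hb hab
    rw [PBW.deformedRel_powRel, hq] at hab
    -- As a value of φ, q(x_1) lies in F^(N-1); this is what bounds the degree of q.
    have hf := hq ▸ (φ ⟨_, PBW.pow_mem_powRel (x ⟨0, hn⟩) N⟩).2
    obtain ⟨m, rfl⟩ : ∃ m, N = m + 1 := ⟨N - 1, by omega⟩
    exact PBW.leading_mem_relIdeal_powRel x _ m q hf ha hb hab
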